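/- Let $K$ be a field. A $K$-variety is a separated $K$-scheme of finite type. For a $K$-variety $W$, an étale image in $W(K)$ is a set of the form $f(V(K))$ with $V$ a $K$-variety and $f\colon V\to W$ an étale morphism of $K$-schemes; the étale open topology $\mathscr{E}_K$ on $W(K)$ is the topology with basis the étale images. An étale image in $K$ is an étale image in $K=\mathbb{A}^1_K(K)$. Field topologies on $K$ are always assumed to be Hausdorff and non-discrete. A field topology $\tau$ on $K$ yields a topology on $W(K)$ for every $K$-variety $W$ (the subspace topology from $K^n$ if $W$ is a closed subvariety of $\mathbb{A}^n$, glued along affine open subvarieties in general), and $\tau$ is said to induce the étale open topology if for every $K$-variety $W$ this topology on $W(K)$ is equal to $\mathscr{E}_K$. A set $B\subseteq K$ is $\tau$-bounded if for every $\tau$-neighbourhood $U$ of $0$ there is a $\tau$-neighbourhood $V$ of $0$ with $V\cdot B\subseteq U$, and $\tau$ is locally bounded if some neighbourhood of $0$ is $\tau$-bounded. Finally, $\tau$ is gt-henselian if for every $n \ge 0$ and every $\tau$-neighbourhood $P$ of $-1$ there is a $\tau$-neighbourhood $O$ of $0$ such that $X^{n+1}+X^n+a_{n-1}X^{n-1}+\dots+a_1X+a_0$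 has a root in $P$ for all $a_0,\dots,a_{n-1}\in O$. **Proposition.** Let $\tau$ be a locally bounded field topology on $K$. Then the following are equivalent: 1. $\tau$ induces the étale open topology; 2. $\tau$ is gt-henselian and some nonempty étale image in $K$ is $\tau$-bounded. In particular, let $R$ be a local domain with fraction field $K$ and $R\neq K$, and let the $R$-adic topology be the field topology on $K$ with basis $\{aR+b : a\in K^\times,\ b\in K\}$. Then the following are equivalent: 3. the $R$-adic topology agrees with (that is, induces) the étale open topology; 4. the $R$-adic topology is gt-henselian and $R$ contains a nonempty étale image in $K$. -/

import Mathlib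

open CategoryTheory AlgebraicGeometry Topology Pointwise

universe u v

namespace EtaleOpen

noncomputable section

/-! ### Field topologies -/

section FieldTopologies

variable (K : Type u) [Field K]

/-- Field topologies on `K`: the ring operations and inversion on `K \ {0}` are continuous and,
by convention, the topology is Hausdorff and not discrete. -/
structure IsFieldTopology (τ : TopologicalSpace K) : Prop where
  isTopologicalDivisionRing : IsTopologicalDivisionRing K
  t2 : T2Space K
  not_discrete : ¬ DiscreteTopology K

variable {K}

/-- `B` is bounded if for every neighbourhood `U` of `0` there is a neighbourhood `V` of `0`
with `V * B ⊆ U`. -/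
def IsBounded (τ : TopologicalSpace K) (B : Set K) : Prop :=
  ∀ U ∈ 𝓝 (0 : K), ∃ V ∈ 𝓝 (0 : K), V * B ⊆ U

/-- There is a bounded neighbourhood of `0`. -/
def IsLocallyBounded (τ : TopologicalSpace K) : Prop :=
  ∃ B ∈ 𝓝 (0 : K), IsBounded τ B

/-- Generalized topological henselianity: for every `n` and every neighbourhood `P` of `-1` there
is a neighbourhood `O` of `0` such that
`X ^ (n + 1) + X ^ n + a (n - 1) X ^ (n - 1) + ⋯ + a 1 X + a 0` has a root in `P` whenever
all the `a i` lie in `O`. -/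
def IsGtHenselian (τ : TopologicalSpace K) : Prop :=
  ∀ n : ℕ, ∀ P ∈ 𝓝 (-1 : K), ∃ O ∈ 𝓝 (0 : K), ∀ a : Fin n → K, (∀ i, a i ∈ O) →
    ∃ x ∈ P, x ^ (n + 1) + x ^ n + ∑ i : Fin n, a i * x ^ (i : ℕ) = 0

/-- The `R`-adic topology on the fraction field `K` of `R`, generated by the sets `a R + b`
with `a ≠ 0`. -/
@[reducible] def adicTopology (R : Type v) [CommRing R] (K : Type u) [Field K] [Algebra R K] :
    TopologicalSpace K :=
  TopologicalSpace.generateFrom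
    {S | ∃ a b : K, a ≠ 0 ∧ S = Set.range fun r : R => a * algebraMap R K r + b}

end FieldTopologies

/-! ### Varieties and rational points -/

section Varieties

variable {K : Type u} [Field K]

/-- A `K`-variety is a separated `K`-scheme of finite type. -/
structure IsVariety (V : Over (Spec (.of K))) : Prop where
  isSeparated : IsSeparated V.hom
  locallyOfFiniteType : LocallyOfFiniteType V.hom
  quasiCompact : QuasiCompact V.hom

/-- The set `V(K)` of `K`-rational points of a `K`-scheme `V`. -/
abbrev RationalPoints (V : Over (Spec (.of K))) : Type u :=
  Over.mk (𝟙 (Spec (.of K))) ⟶ V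

/-- The value `g(x) ∈ K` of a global function `g` on `V` at a rational point `x ∈ V(K)`. -/
def evalAt (V : Over (Spec (.of K))) (g : Γ(V.left, ⊤)) (x : RationalPoints V) : K :=
  (Scheme.ΓSpecIso (.of K)).hom (x.left.appTop g)

/-- The affine line `Spec K[X]` over `K`. -/
def affineLine (K : Type u) [Field K] : Over (Spec (.of K)) :=
  Over.mk (Spec.map (CommRingCat.ofHom (Polynomial.C : K →+* Polynomial K)))

/-- The identification of the rational points of the affine line with `K`, given by
evaluating the coordinate function. -/
def affineLineCoord (x : RationalPoints (affineLine K)) : K :=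
  evalAt (affineLine K) ((Scheme.ΓSpecIso (.of (Polynomial K))).inv Polynomial.X) x

/-! ### The topology on rational points induced by a topology on `K` -/

/-- The coarsest topology on `V(K)` for which every global function `V(K) → K` is continuous.
For an affine `K`-variety embedded as a closed subvariety of affine `n`-space and a ring topology
on `K` this is the subspace topology from the product topology on `Kⁿ`. -/
@[reducible] def affinePointsTopology (τ : TopologicalSpace K) (V : Over (Spec (.of K))) :
    TopologicalSpace (RationalPoints V) :=
  ⨅ g : Γ(V.left, ⊤), τ.induced (evalAt V g)

/-- An open subscheme of a `K`-scheme, as a `K`-scheme. -/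
def openSubscheme (V : Over (Spec (.of K))) (U : V.left.Opens) : Over (Spec (.of K)) :=
  Over.mk (U.ι ≫ V.hom)

/-- The inclusion of an open subscheme. -/
def openInclusion (V : Over (Spec (.of K))) (U : V.left.Opens) : openSubscheme V U ⟶ V :=
  Over.homMk U.ι rfl

/-- The topology on `V(K)` induced by a field topology on `K`, glued from affine open pieces:
a subset of `V(K)` is open if and only if its trace on `U(K)` is open for every affine open
subscheme `U` of `V`. -/
@[reducible] def pointsTopology (τ : TopologicalSpace K) (V : Over (Spec (.of K))) :
    TopologicalSpace (RationalPoints V) :=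
  ⨆ U : V.left.affineOpens,
    (affinePointsTopology τ (openSubscheme V U.1)).coinduced
      fun x => x ≫ openInclusion V U.1

/-! ### The étale open topology -/

/-- Étale images in `W(K)`: sets `f(V(K))` for `f : V ⟶ W` an étale morphism of `K`-schemes,
where `V` is a `K`-variety. -/
def IsEtaleImage (W : Over (Spec (.of K))) (S : Set (RationalPoints W)) : Prop :=
  ∃ V : Over (Spec (.of K)), IsVariety V ∧ ∃ f : V ⟶ W, Etale f.left ∧
    S = Set.range fun x : RationalPoints V => x ≫ f

/-- Étale images in `K`, the set of rational points of the affine line. -/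
def IsEtaleImageInField (U : Set K) : Prop :=
  ∃ S : Set (RationalPoints (affineLine K)), IsEtaleImage (affineLine K) S ∧
    U = affineLineCoord '' S

/-- The étale open topology on `W(K)`, generated by the étale images. -/
@[reducible] def etaleOpenTopology (W : Over (Spec (.of K))) : TopologicalSpace (RationalPoints W) :=
  TopologicalSpace.generateFrom {S | IsEtaleImage W S}

/-- `τ` induces the étale open topology: both topologies agree on `W(K)` for
every `K`-variety `W`. -/
def InducesEtaleOpenTopology (τ : TopologicalSpace K) : Prop :=
  ∀ W : Over (Spec (.of K)), IsVariety W → pointsTopology τ W = etaleOpenTopology W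

end Varieties

end

end EtaleOpen

namespace EtaleOpen

/-! ### The implicit function theorem for gt-henselian fields -/

section Henselian

open Polynomial Filter

/-! The equality of topologies splits into two inclusions, each governed by one half of the second
condition.

Gt-henselianity makes étale images `τ`-open. It implies that simple roots of polynomials persist
under small changes of the coefficients (`IsGtHenselian.eventually_exists_root`). An étale morphism
is locally given by a simple root, so its rational points deform along the base
(`IsGtHenselian.eventually_exists_ringHom_of_etale`), and images on `K`-points are open.

A nonempty bounded étale image `U` makes the étale open topology finer than `τ`. As `τ` is not
discrete, `U` can be scaled by a nonzero `a` into any neighbourhood of `0` and then translated. Thus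
each `τ`-open set contains an étale image around each of its points, so global functions are
continuous for the étale open topology (`continuous_evalAt_etaleOpenTopology`).

Conversely, if the topologies agree, a bounded neighbourhood of `0` contains an étale image.
Gt-henselianity follows by projecting the locus of simple roots of the generic polynomial to its
coefficient space: this is an étale map, hence open on `K`-points.

For the `R`-adic topology, locality of `R` gives continuity of inversion, `R` is itself a bounded
neighbourhood of `0`, and a bounded étale image can be scaled into `R`. -/

theorem sum_eq_zero_of_reverse_root {K : Type u} [Field K] {N : ℕ} (c : ℕ → K) (h1 : c 1 ≠ 0) {z : K} (hz : z ≠ 0)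
    (h : z ^ (N + 1) + z ^ N +
      ∑ i : Fin N, c (N + 1 - i) * c 0 ^ (N - i : ℕ) / c 1 ^ (N + 1 - i : ℕ) * z ^ (i : ℕ) = 0) :
    ∑ i ∈ Finset.range (N + 2), c i * (c 0 / c 1 * z⁻¹) ^ i = 0 := by
  rw [Fin.sum_univ_eq_sum_range
    (fun i => c (N + 1 - i) * c 0 ^ (N - i : ℕ) / c 1 ^ (N + 1 - i : ℕ) * z ^ i),
    ← Finset.sum_range_reflect] at h
  rw [Finset.sum_range_succ', Finset.sum_range_succ']
  -- Substituting `x = (c 0 / c 1) z⁻¹` turns the sum into `c 0 * z ^ -(N + 1)` times the polynomial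
  -- in `z`: the constant and linear terms give `z ^ (N + 1) + z ^ N`, and the term of degree `k +
  -- 2` gives that of degree `N - 1 - k`. There is no division by `c 0`, so `c 0 = 0` is allowed.
  have key : ∀ k ∈ Finset.range N, c (k + 1 + 1) * (c 0 / c 1 * z⁻¹) ^ (k + 1 + 1) =
      c 0 * (z ^ (N + 1))⁻¹ * (c (N + 1 - (N - 1 - k)) * c 0 ^ (N - (N - 1 - k)) /
        c 1 ^ (N + 1 - (N - 1 - k)) * z ^ (N - 1 - k)) := by
    intro k hk
    obtain ⟨m, rfl⟩ : ∃ m, N = k + 1 + m := Nat.exists_eq_add_of_le (Finset.mem_range.1 hk)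
    rw [show k + 1 + m - 1 - k = m by omega, show k + 1 + m + 1 - m = k + 1 + 1 by omega,
      show k + 1 + m - m = k + 1 by omega]
    simp only [mul_pow, div_pow, inv_pow]
    field_simp
    ring
  rw [Finset.sum_congr rfl key, ← Finset.mul_sum]
  have : c (0 + 1) * (c 0 / c 1 * z⁻¹) ^ (0 + 1) + c 0 * (c 0 / c 1 * z⁻¹) ^ 0 =
      c 0 * (z ^ (N + 1))⁻¹ * (z ^ (N + 1) + z ^ N) := by
    simp only [zero_add]
    field_simp
    ring
  rw [add_assoc, this, ← mul_add, add_comm (Finset.sum _ _), h, mul_zero]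

variable {K : Type u} [Field K] [τ : TopologicalSpace K] [IsTopologicalDivisionRing K]
  {T : Type*} [TopologicalSpace T]

/-- A polynomial with coefficients continuous at `t₀`, vanishing to order one at `0` for `t = t₀`,
has a root close to `0` for `t` close to `t₀`. -/
theorem IsGtHenselian.eventually_exists_root_zero [T2Space K] (h : IsGtHenselian τ) {t₀ : T} (N : ℕ)
    (c : ℕ → T → K) (hc : ∀ i, ContinuousAt (c i) t₀) (h0 : c 0 t₀ = 0) (h1 : c 1 t₀ ≠ 0)
    {P : Set K} (hP : P ∈ 𝓝 (0 : K)) :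
    ∀ᶠ t in 𝓝 t₀, ∃ x ∈ P, ∑ i ∈ Finset.range (N + 2), c i t * x ^ i = 0 := by
  have hcont : Tendsto (fun q : T × K => c 0 q.1 / c 1 q.1 * q.2⁻¹) (𝓝 t₀ ×ˢ 𝓝 (-1 : K)) (𝓝 0) := by
    have hA : Tendsto (fun q : T × K => c 0 q.1 / c 1 q.1) (𝓝 t₀ ×ˢ 𝓝 (-1 : K)) (𝓝 0) := by
      have := (((hc 0).tendsto).div (hc 1).tendsto h1).comp (tendsto_fst (g := 𝓝 (-1 : K)))
      simpa [h0] using! this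
    have hB : Tendsto (fun q : T × K => q.2⁻¹) (𝓝 t₀ ×ˢ 𝓝 (-1 : K)) (𝓝 (-1)⁻¹) :=
      (tendsto_inv₀ (by simp)).comp tendsto_snd
    simpa using hA.mul hB
  obtain ⟨A, hA, B, hB, hAB⟩ := Filter.eventually_prod_iff.1 (hcont.eventually hP)
  obtain ⟨O, hO, hroot⟩ := h N _ (hB.and (eventually_ne_nhds (b := (0 : K)) (by simp)))
  -- For `i < N` the exponent of `c 0 t` is at least one, so each coefficient vanishes at `t₀`.
  have hsmall : ∀ᶠ t in 𝓝 t₀, ∀ i : Fin N,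
      c (N + 1 - i) t * c 0 t ^ (N - i : ℕ) / c 1 t ^ (N + 1 - i : ℕ) ∈ O := by
    refine Filter.eventually_all.2 fun i => ?_
    have : ContinuousAt
        (fun t => c (N + 1 - i) t * c 0 t ^ (N - i : ℕ) / c 1 t ^ (N + 1 - i : ℕ)) t₀ :=
      ((hc _).mul ((hc 0).pow _)).div ((hc 1).pow _) (pow_ne_zero _ h1)
    refine this.tendsto.eventually ?_
    rwa [h0, zero_pow (by omega), mul_zero, zero_div]
  filter_upwards [hA, hsmall, (hc 1).eventually_ne h1] with t htA htO ht1
  obtain ⟨z, ⟨hzB, hz0⟩, hz⟩ := hroot _ htO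
  exact ⟨_, hAB htA hzB, sum_eq_zero_of_reverse_root (fun i => c i t) ht1 hz0 hz⟩

theorem IsGtHenselian.eventually_exists_root [T2Space K] (h : IsGtHenselian τ) {t₀ : T}
    (p : T → K[X]) (N : ℕ) (hN : ∀ t, (p t).natDegree ≤ N)
    (hp : ∀ i, ContinuousAt (fun t => (p t).coeff i) t₀)
    {x₀ : K} (h0 : (p t₀).eval x₀ = 0) (h1 : (p t₀).derivative.eval x₀ ≠ 0)
    {P : Set K} (hP : P ∈ 𝓝 x₀) :
    ∀ᶠ t in 𝓝 t₀, ∃ x ∈ P, (p t).eval x = 0 := by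
  -- Recentring at `x₀` reduces to the root `0`; the uniform degree bound makes each Taylor
  -- coefficient a fixed finite sum of continuous terms.
  have hc : ∀ i, ContinuousAt (fun t => (taylor x₀ (p t)).coeff i) t₀ := by
    intro i
    have : (fun t => (taylor x₀ (p t)).coeff i) = fun t => ∑ j ∈ Finset.range (N + 1),
        (j.choose i : K) * (p t).coeff j * x₀ ^ (j - i) := by
      funext t
      rw [taylor_coeff, hasseDeriv_apply, eval_sum,
        sum_over_range' _ _ (N + 1) (Nat.lt_succ_of_le (hN t))]
      · simp [eval_monomial]
      · simp
    rw [this]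
    refine tendsto_finsetSum _ fun j _ => ?_
    exact ((continuousAt_const.mul (hp j)).mul continuousAt_const)
  have hP' : (fun y => y + x₀) ⁻¹' P ∈ 𝓝 (0 : K) := by
    have : ContinuousAt (fun y : K => y + x₀) 0 := by fun_prop
    exact this (by simpa using hP)
  filter_upwards [h.eventually_exists_root_zero N _ hc (by simpa using h0)
    (by simpa [taylor_coeff_one] using h1) hP'] with t ⟨x, hx, hsum⟩
  refine ⟨x + x₀, hx, ?_⟩
  rw [← taylor_eval, eval_eq_sum_range' (n := N + 2), hsum]
  rw [natDegree_taylor]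
  exact (hN t).trans_lt (by omega)

theorem eventually_eval_ne_zero [T2Space K] {t₀ : T} (p : T → K[X]) (N : ℕ)
    (hN : ∀ t, (p t).natDegree ≤ N) (hp : ∀ i, ContinuousAt (fun t => (p t).coeff i) t₀)
    {x₀ : K} (h0 : (p t₀).eval x₀ ≠ 0) :
    ∃ P ∈ 𝓝 x₀, ∀ᶠ t in 𝓝 t₀, ∀ x ∈ P, (p t).eval x ≠ 0 := by
  have : Tendsto (fun q : T × K => (p q.1).eval q.2) (𝓝 t₀ ×ˢ 𝓝 x₀) (𝓝 ((p t₀).eval x₀)) := by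
    have : (fun q : T × K => (p q.1).eval q.2) = fun q => ∑ i ∈ Finset.range (N + 1),
        (p q.1).coeff i * q.2 ^ i := by
      funext q
      rw [eval_eq_sum_range' (Nat.lt_succ_of_le (hN q.1))]
    rw [this, eval_eq_sum_range' (Nat.lt_succ_of_le (hN t₀))]
    exact tendsto_finsetSum _ fun i _ => ((hp i).tendsto.comp tendsto_fst).mul (tendsto_snd.pow i)
  obtain ⟨A, hA, B, hB, hAB⟩ := Filter.eventually_prod_iff.1 (this.eventually_ne h0)
  exact ⟨{x | B x}, hB, hA.mono fun t ht x hx => hAB ht hx⟩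

/-- Points of étale algebras with values in a gt-henselian field deform along the base. -/
theorem IsGtHenselian.eventually_exists_ringHom_of_etale [T2Space K] (h : IsGtHenselian τ)
    {A B : Type*} [CommRing A] [CommRing B] [Algebra A B] [Algebra.Etale A B]
    {t₀ : T} (ψ : T → A →+* K) (hψ : ∀ a, ContinuousAt (fun t => ψ t a) t₀)
    (φ : B →+* K) (hφ : φ.comp (algebraMap A B) = ψ t₀) :
    ∀ᶠ t in 𝓝 t₀, ∃ φ' : B →+* K, φ'.comp (algebraMap A B) = ψ t := by
  have : (RingHom.ker φ).IsPrime := RingHom.ker_isPrime φ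
  have : Algebra.IsEtaleAt A (RingHom.ker φ) := inferInstance
  obtain ⟨f, hf, ⟨⟨P⟩⟩⟩ := Algebra.IsEtaleAt.exists_isStandardEtale (R := A) (RingHom.ker φ)
  have hfu : IsUnit (φ f) := (Ne.isUnit hf)
  let φ₁ : Localization.Away f →+* K := IsLocalization.Away.lift f hfu
  have hφ₁ : φ₁.comp (algebraMap A (Localization.Away f)) = ψ t₀ := by
    rw [← hφ, IsScalarTower.algebraMap_eq A B (Localization.Away f), ← RingHom.comp_assoc,
      IsLocalization.Away.lift_comp]
  have hev : ∀ q : A[X], (q.map (ψ t₀)).eval (φ₁ P.x) = φ₁ (aeval P.x q) := by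
    intro q
    rw [Polynomial.eval_map, ← hφ₁, aeval_def, hom_eval₂]
  have hdeg : ∀ (q : A[X]) t, (q.map (ψ t)).natDegree ≤ q.natDegree := fun q t => natDegree_map_le
  have hcont : ∀ (q : A[X]) i, ContinuousAt (fun t => (q.map (ψ t)).coeff i) t₀ := by
    intro q i
    simpa only [coeff_map] using hψ _
  obtain ⟨O, hO, hO'⟩ := eventually_eval_ne_zero (fun t => P.g.map (ψ t)) _ (hdeg P.g) (hcont P.g)
    (x₀ := φ₁ P.x) (by rw [hev]; exact (P.hasMap.2.map φ₁).ne_zero)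
  filter_upwards [hO', h.eventually_exists_root (fun t => P.f.map (ψ t)) _ (hdeg P.f) (hcont P.f)
    (x₀ := φ₁ P.x) (by rw [hev, P.hasMap.1, map_zero])
    (by rw [derivative_map, hev]; exact (P.hasMap.isUnit_derivative_f.map φ₁).ne_zero) hO]
    with t hg ⟨x, hxO, hx⟩
  -- With `K` an `A`-algebra through `ψ t`, being `A`-linear is exactly the required compatibility.
  algebraize [ψ t]
  have hmap : P.HasMap x :=
    ⟨by rwa [aeval_def, eval₂_eq_eval_map],
      Ne.isUnit (by rw [aeval_def, eval₂_eq_eval_map]; exact hg x hxO)⟩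
  let σ : Localization.Away f →ₐ[A] K := (P.lift x hmap).comp P.equivRing.toAlgHom
  refine ⟨σ.toRingHom.comp (algebraMap B (Localization.Away f)), ?_⟩
  rw [RingHom.comp_assoc, ← IsScalarTower.algebraMap_eq A B (Localization.Away f)]
  exact σ.comp_algebraMap

end Henselian

/-! ### The `R`-adic topology -/

section Adic

open Filter

variable {K : Type u} [Field K] {R : Type v} [CommRing R] [Algebra R K]

variable (R) in
/-- The set `a R + b`. -/
def affineSet (a b : K) : Set K :=
  Set.range fun r : R => a * algebraMap R K r + b

theorem self_mem_affineSet (a b : K) : b ∈ affineSet R a b := ⟨0, by simp⟩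

theorem affineSet_subset_of_mem {a b c : K} (h : c ∈ affineSet R a b) :
    affineSet R a c ⊆ affineSet R a b := by
  obtain ⟨r, rfl⟩ := h
  rintro _ ⟨s, rfl⟩
  exact ⟨s + r, by simp only [map_add]; ring⟩

theorem affineSet_mul_subset (a b : K) (r : R) :
    affineSet R (a * algebraMap R K r) b ⊆ affineSet R a b := by
  rintro _ ⟨s, rfl⟩
  exact ⟨r * s, by simp only [map_mul]; ring⟩

variable [IsDomain R] [IsFractionRing R K]

theorem exists_affineSet_subset_inter {a b : K} (ha : a ≠ 0) (hb : b ≠ 0) (x : K) :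
    ∃ c ≠ 0, affineSet R c x ⊆ affineSet R a x ∩ affineSet R b x := by
  obtain ⟨p, q, hq, hpq⟩ := IsFractionRing.div_surjective (A := R) (b / a)
  have hq0 : algebraMap R K q ≠ 0 := IsFractionRing.to_map_ne_zero_of_mem_nonZeroDivisors hq
  have h : b * algebraMap R K q = a * algebraMap R K p := by
    field_simp at hpq
    linear_combination -hpq
  -- Writing `b / a = p / q` gives the common multiple `b q = a p`.
  refine ⟨b * algebraMap R K q, mul_ne_zero hb hq0, fun y hy => ⟨?_, ?_⟩⟩
  · rw [h] at hy
    exact affineSet_mul_subset _ _ _ hy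
  · exact affineSet_mul_subset _ _ _ hy

variable (R) in
theorem nhds_adicTopology_hasBasis (x : K) :
    (@nhds K (adicTopology R K) x).HasBasis (fun a : K => a ≠ 0) fun a => affineSet R a x := by
  have hB : @TopologicalSpace.IsTopologicalBasis K (adicTopology R K)
      {S | ∃ a b : K, a ≠ 0 ∧ S = affineSet R a b} := by
    let _ := adicTopology R K
    refine ⟨?_, ?_, rfl⟩
    · rintro _ ⟨a, b, ha, rfl⟩ _ ⟨a', b', ha', rfl⟩ x ⟨hx, hx'⟩
      obtain ⟨c, hc, hsub⟩ := exists_affineSet_subset_inter (R := R) ha ha' x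
      exact ⟨_, ⟨c, x, hc, rfl⟩, self_mem_affineSet _ _, hsub.trans
        (Set.inter_subset_inter (affineSet_subset_of_mem hx) (affineSet_subset_of_mem hx'))⟩
    · exact Set.eq_univ_of_forall fun x =>
        ⟨_, ⟨1, x, one_ne_zero, rfl⟩, self_mem_affineSet _ _⟩
  let _ := adicTopology R K
  refine ⟨fun S => ?_⟩
  rw [hB.mem_nhds_iff]
  constructor
  · rintro ⟨_, ⟨a, b, ha, rfl⟩, hx, hS⟩
    exact ⟨a, ha, (affineSet_subset_of_mem hx).trans hS⟩
  · rintro ⟨a, ha, hS⟩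
    exact ⟨_, ⟨a, x, ha, rfl⟩, self_mem_affineSet _ _, hS⟩

variable (R) in
theorem range_algebraMap_mem_nhds_zero :
    Set.range (algebraMap R K) ∈ @nhds K (adicTopology R K) 0 := by
  refine (nhds_adicTopology_hasBasis R (0 : K)).mem_iff.2 ⟨1, one_ne_zero, ?_⟩
  rintro _ ⟨r, rfl⟩
  exact ⟨r, by simp⟩

variable (R) in
theorem isBounded_adicTopology_range : IsBounded (adicTopology R K) (Set.range (algebraMap R K)) := by
  intro U hU
  obtain ⟨a, ha, hU⟩ := (nhds_adicTopology_hasBasis R (0 : K)).mem_iff.1 hU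
  refine ⟨_, (nhds_adicTopology_hasBasis R (0 : K)).mem_of_mem ha, ?_⟩
  rintro _ ⟨_, ⟨r, rfl⟩, _, ⟨s, rfl⟩, rfl⟩
  exact hU ⟨r * s, by simp [mul_assoc]⟩

variable (R) in
theorem isLocallyBounded_adicTopology : IsLocallyBounded (adicTopology R K) :=
  ⟨_, range_algebraMap_mem_nhds_zero R, isBounded_adicTopology_range R⟩

/-- `R` is not a field, so its maximal ideal has a nonzero element `m`, and `1 + m r` is then a
unit. -/
theorem exists_isUnit_one_add_mul [IsLocalRing R] (hR : ¬ Function.Surjective (algebraMap R K)) :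
    ∃ m : R, m ≠ 0 ∧ ∀ r, IsUnit (1 + m * r) := by
  have hf : ¬ IsField R := fun hf => hR (IsFractionRing.surjective_iff_isField.mpr hf)
  rw [IsLocalRing.isField_iff_maximalIdeal_eq] at hf
  obtain ⟨m, hm, hm0⟩ := Submodule.exists_mem_ne_zero_of_ne_bot hf
  refine ⟨m, hm0, fun r => ?_⟩
  refine (IsLocalRing.isUnit_or_isUnit_of_add_one (a := 1 + m * r) (b := -(m * r)) (by ring)).resolve_right ?_
  exact fun h => (IsLocalRing.mem_maximalIdeal _).1 (Ideal.mul_mem_right r _ hm) (by simpa using h.neg)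

variable (R) in
theorem isTopologicalRing_adicTopology : @IsTopologicalRing K (adicTopology R K) _ := by
  let _ := adicTopology R K
  have hb := nhds_adicTopology_hasBasis R (K := K)
  have hmul : ∀ x₀ : K, Tendsto (fun x => x₀ * x) (𝓝 0) (𝓝 0) := by
    intro x₀
    rcases eq_or_ne x₀ 0 with rfl | hx
    · simpa using tendsto_const_nhds
    · refine ((hb 0).tendsto_iff (hb 0)).2 fun c hc => ⟨x₀⁻¹ * c, by simp [hx, hc], ?_⟩
      rintro _ ⟨r, rfl⟩
      exact ⟨r, by field_simp; simp⟩
  refine IsTopologicalRing.of_nhds_zero ?_ ?_ ?_ hmul ?_ ?_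
  · refine (((hb 0).prod (hb 0)).tendsto_iff (hb 0)).2 fun c hc => ⟨(c, c), ⟨hc, hc⟩, ?_⟩
    rintro ⟨_, _⟩ ⟨⟨r, rfl⟩, ⟨s, rfl⟩⟩
    exact ⟨r + s, by simp [mul_add]⟩
  · refine ((hb 0).tendsto_iff (hb 0)).2 fun c hc => ⟨c, hc, ?_⟩
    rintro _ ⟨r, rfl⟩
    exact ⟨-r, by simp⟩
  · refine (((hb 0).prod (hb 0)).tendsto_iff (hb 0)).2
      fun c hc => ⟨(c, 1), ⟨hc, one_ne_zero⟩, ?_⟩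
    rintro ⟨_, _⟩ ⟨⟨r, rfl⟩, ⟨s, rfl⟩⟩
    exact ⟨r * s, by simp [mul_assoc]⟩
  · simpa only [mul_comm] using hmul
  · intro x₀
    refine (hb x₀).eq_of_same_basis ?_
    convert! (hb 0).map (fun x => x₀ + x) using 2 with a
    rw [affineSet, affineSet, ← Set.range_comp]
    exact congrArg Set.range (funext fun r => by simp [add_comm])

variable (R) in
theorem continuousInv₀_adicTopology [IsLocalRing R]
    (hR : ¬ Function.Surjective (algebraMap R K)) : @ContinuousInv₀ K _ _ (adicTopology R K) := by
  let _ := adicTopology R K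
  have hb := nhds_adicTopology_hasBasis R (K := K)
  obtain ⟨m, hm, hmu⟩ := exists_isUnit_one_add_mul hR
  have hm' : algebraMap R K m ≠ 0 := by simpa using hm
  refine ⟨fun x hx => ((hb x).tendsto_iff (hb x⁻¹)).2 fun c hc => ?_⟩
  -- For `s` in `R` write `b s = m r₁ = c x r₂`. The first form makes `w = 1 + b s` a unit of `R`;
  -- the second turns `(x w)⁻¹ - x⁻¹ = -b s / (x w)` into `-c r₂ w⁻¹`, which lies in `c R`.
  obtain ⟨b, hb0, hsub⟩ := exists_affineSet_subset_inter (R := R) hm' (mul_ne_zero hc hx) 0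
  refine ⟨x * b, mul_ne_zero hx hb0, ?_⟩
  rintro _ ⟨s, rfl⟩
  obtain ⟨⟨r₁, h₁⟩, ⟨r₂, h₂⟩⟩ := hsub ⟨s, rfl⟩
  simp only [add_zero] at h₁ h₂
  obtain ⟨w, hw⟩ := hmu r₁
  have hw' : algebraMap R K w = 1 + b * algebraMap R K s := by rw [hw, ← h₁]; simp
  have hwi : algebraMap R K w * algebraMap R K ↑w⁻¹ = 1 := by rw [← map_mul]; simp
  have hw0 : algebraMap R K w ≠ 0 := left_ne_zero_of_mul_eq_one hwi
  refine ⟨-(r₂ * ↑w⁻¹), ?_⟩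
  have hx' : x * b * algebraMap R K s + x = x * algebraMap R K w := by rw [hw']; ring
  beta_reduce
  rw [hx', map_neg, map_mul, eq_inv_of_mul_eq_one_right hwi]
  field_simp
  linear_combination -h₂ + hw'

variable (R) in
theorem isFieldTopology_adicTopology [IsLocalRing R]
    (hR : ¬ Function.Surjective (algebraMap R K)) : IsFieldTopology K (adicTopology R K) := by
  let _ := adicTopology R K
  have hb := nhds_adicTopology_hasBasis R (K := K)
  have := isTopologicalRing_adicTopology R (K := K)
  have := continuousInv₀_adicTopology R hR
  refine ⟨{}, ?_, ?_⟩
  · obtain ⟨k, hk⟩ := not_forall.1 hR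
    have hk0 : k ≠ 0 := by rintro rfl; exact hk ⟨0, map_zero _⟩
    refine ⟨fun x y hxy => ?_⟩
    -- With `k` outside `R`, a common point of the neighbourhoods of `x` and `y` at this scale would
    -- express `k` as a difference of elements of `R`.
    have hc : (y - x) / k ≠ 0 := div_ne_zero (sub_ne_zero.2 hxy.symm) hk0
    obtain ⟨U, hU, hUo, hxU⟩ := mem_nhds_iff.1 ((hb x).mem_of_mem hc)
    obtain ⟨V, hV, hVo, hyV⟩ := mem_nhds_iff.1 ((hb y).mem_of_mem hc)
    refine ⟨U, V, hUo, hVo, hxU, hyV, Set.disjoint_left.2 fun z hzU hzV => hk ?_⟩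
    obtain ⟨r, hr⟩ := hU hzU
    obtain ⟨s, hs⟩ := hV hzV
    refine ⟨r - s, mul_left_cancel₀ hc ?_⟩
    rw [map_sub, div_mul_cancel₀ _ hk0]
    linear_combination hr - hs
  · intro hd
    obtain ⟨a, ha, hsub⟩ := (hb 0).mem_iff.1 (mem_nhds_discrete.2 (Set.mem_singleton (0 : K)))
    exact ha (by simpa using hsub ⟨1, rfl⟩)

end Adic

/-! ### Varieties, rational points and étale images -/

section Varieties

open Limits

variable {K : Type u} [Field K]

theorem quasiCompact_left {V W : Over (Spec (.of K))} (hV : IsVariety V) (hW : IsVariety W)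
    (f : V ⟶ W) : QuasiCompact f.left := by
  have := hW.isSeparated
  have := hV.quasiCompact
  rw [← Over.w f] at this
  exact QuasiCompact.of_comp f.left W.hom

theorem isSeparated_left {V W : Over (Spec (.of K))} (hV : IsVariety V) (f : V ⟶ W) :
    IsSeparated f.left := by
  have := hV.isSeparated
  rw [← Over.w f] at this
  exact IsSeparated.of_comp f.left W.hom

theorem isVariety_of_isAffine (V : Over (Spec (.of K))) [IsAffine V.left]
    [LocallyOfFiniteType V.hom] : IsVariety V :=
  ⟨inferInstance, inferInstance, inferInstance⟩

theorem isVariety_openSubscheme {W : Over (Spec (.of K))} (hW : IsVariety W) {U : W.left.Opens}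
    (hU : IsAffineOpen U) : IsVariety (openSubscheme W U) := by
  have : IsAffine (openSubscheme W U).left := hU
  have := hW.locallyOfFiniteType
  have : LocallyOfFiniteType (openSubscheme W U).hom :=
    inferInstanceAs (LocallyOfFiniteType (U.ι ≫ W.hom))
  exact isVariety_of_isAffine _

/-- The function `V(K) → K` attached to a global function is evaluation at a ring homomorphism. -/
noncomputable def evalHom (V : Over (Spec (.of K))) (x : RationalPoints V) : Γ(V.left, ⊤) →+* K :=
  ((Scheme.ΓSpecIso (.of K)).hom.hom).comp x.left.appTop.hom

theorem evalAt_comp {V W : Over (Spec (.of K))} (f : V ⟶ W) (g : Γ(W.left, ⊤))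
    (x : RationalPoints V) : evalAt W g (x ≫ f) = evalAt V (f.left.appTop g) x := by
  simp [evalAt]
  rfl

/-! Étale images. -/

theorem isEtaleImage_univ {W : Over (Spec (.of K))} (hW : IsVariety W) :
    IsEtaleImage W Set.univ :=
  ⟨W, hW, 𝟙 W, by rw [Over.id_left]; infer_instance, by simp⟩

theorem IsEtaleImage.image {V W : Over (Spec (.of K))} {S : Set (RationalPoints V)}
    (hS : IsEtaleImage V S) (f : V ⟶ W) [Etale f.left] :
    IsEtaleImage W ((fun x => x ≫ f) '' S) := by
  obtain ⟨V', hV', g, hg, rfl⟩ := hS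
  refine ⟨V', hV', g ≫ f, by rw [Over.comp_left]; infer_instance, ?_⟩
  rw [← Set.range_comp]
  simp [Function.comp_def]

/-- Base change: a rational point of the fibre product is a pair of compatible rational points. -/
theorem IsEtaleImage.preimage {V W : Over (Spec (.of K))} {S : Set (RationalPoints W)}
    (hS : IsEtaleImage W S) (hW : IsVariety W) (hV : IsVariety V) (f : V ⟶ W) :
    IsEtaleImage V ((fun x => x ≫ f) ⁻¹' S) := by
  obtain ⟨E, hE, g, hg, rfl⟩ := hS
  have := quasiCompact_left hE hW g
  have := isSeparated_left hE g
  let P : Over (Spec (.of K)) := Over.mk (pullback.snd g.left f.left ≫ V.hom)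
  let p : P ⟶ V := Over.homMk (pullback.snd g.left f.left) rfl
  have : Etale p.left := inferInstanceAs (Etale (pullback.snd g.left f.left))
  obtain ⟨_, _, _⟩ := hV
  refine ⟨P, ⟨?_, ?_, ?_⟩, p, this, ?_⟩
  · dsimp [P]; infer_instance
  · dsimp [P]; infer_instance
  · dsimp [P]; infer_instance
  · ext x
    constructor
    · rintro ⟨y, hy⟩
      have h : y.left ≫ g.left = x.left ≫ f.left := congr(($hy).left)
      have hx : pullback.lift y.left x.left h ≫ pullback.snd g.left f.left = x.left :=
        pullback.lift_snd _ _ _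
      refine ⟨Over.homMk (pullback.lift y.left x.left h) ?_, ?_⟩
      · exact (Category.assoc _ _ _).symm.trans
          ((congrArg (fun h => h ≫ V.hom) hx).trans (Over.w x))
      · ext1
        exact hx
    · rintro ⟨z, rfl⟩
      refine ⟨Over.homMk (z.left ≫ pullback.fst g.left f.left) ?_, ?_⟩
      · have := Over.w z
        simp only [P, Over.mk_hom, ← Over.w f] at this
        refine Eq.trans ?_ this
        rw [← Over.w g, Category.assoc, pullback.condition_assoc]
      · ext1
        simp [p, pullback.condition]

theorem IsEtaleImage.inter {W : Over (Spec (.of K))} (hW : IsVariety W)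
    {S T : Set (RationalPoints W)} (hS : IsEtaleImage W S) (hT : IsEtaleImage W T) :
    IsEtaleImage W (S ∩ T) := by
  obtain ⟨E, hE, g, hg, rfl⟩ := hS
  have := (hT.preimage hW hE g).image g
  rwa [Set.image_preimage_eq_range_inter] at this

theorem isTopologicalBasis_etaleOpenTopology {W : Over (Spec (.of K))} (hW : IsVariety W) :
    @TopologicalSpace.IsTopologicalBasis _ (etaleOpenTopology W) {S | IsEtaleImage W S} := by
  let _ := etaleOpenTopology W
  exact ⟨fun S hS T hT x hx => ⟨_, IsEtaleImage.inter hW hS hT, hx, subset_rfl⟩,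
    Set.eq_univ_of_forall fun x => ⟨_, isEtaleImage_univ hW, trivial⟩, rfl⟩

end Varieties

/-! ### Affine schemes over `K` -/

section Affine

variable {K : Type u} [Field K]

/-- The structure homomorphism `K → Γ(V)` of a `K`-scheme. -/
noncomputable def structureHom (V : Over (Spec (.of K))) : K →+* Γ(V.left, ⊤) :=
  V.hom.appTop.hom.comp (Scheme.ΓSpecIso (.of K)).inv.hom

theorem evalAt_structureHom (V : Over (Spec (.of K))) (c : K) (x : RationalPoints V) :
    evalAt V (structureHom V c) x = c := by
  have h : V.hom.appTop ≫ x.left.appTop = 𝟙 _ := by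
    rw [← Scheme.Hom.comp_appTop]
    exact (congrArg Scheme.Hom.appTop (Over.w x)).trans Scheme.Hom.id_appTop
  have := congr((Scheme.ΓSpecIso (.of K)).hom ($h ((Scheme.ΓSpecIso (.of K)).inv c)))
  simpa [evalAt, structureHom] using! this

/-- The spectrum of a `K`-algebra, as a `K`-scheme. -/
noncomputable def specOver (K A : Type u) [Field K] [CommRing A] [Algebra K A] : Over (Spec (.of K)) :=
  Over.mk (Spec.map (CommRingCat.ofHom (algebraMap K A)))

variable {A : Type u} [CommRing A] [Algebra K A]

instance isAffine_specOver : IsAffine (specOver K A).left := inferInstanceAs (IsAffine (Spec _))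

variable (K) in
/-- An element of `A` as a global function on `Spec A`. -/
noncomputable def specFun (a : A) : Γ((specOver K A).left, ⊤) := (Scheme.ΓSpecIso (.of A)).inv a

theorem structureHom_specOver (c : K) :
    structureHom (specOver K A) c = specFun K (algebraMap K A c) :=
  congr($(Scheme.ΓSpecIso_inv_naturality (CommRingCat.ofHom (algebraMap K A))) c).symm

/-- The value at a rational point of `Spec A` of an element of `A`. -/
noncomputable def evalSpec (x : RationalPoints (specOver K A)) : A →ₐ[K] K where
  __ := (evalHom (specOver K A) x).comp (Scheme.ΓSpecIso (.of A)).inv.hom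
  commutes' c :=
    (congrArg (fun g => evalAt _ g x) (structureHom_specOver c)).symm.trans
      (evalAt_structureHom (specOver K A) c x)

theorem evalSpec_apply (x : RationalPoints (specOver K A)) (a : A) :
    evalSpec x a = evalAt (specOver K A) (specFun K a) x := rfl

theorem affineLineCoord_eq (x : RationalPoints (affineLine K)) :
    affineLineCoord x = evalSpec (A := Polynomial K) x .X := rfl

theorem evalSpec_injective : Function.Injective (evalSpec (K := K) (A := A)) := by
  intro x y h
  ext1
  refine ext_of_isAffine ?_
  rw [← cancel_mono (Scheme.ΓSpecIso (.of K)).hom]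
  refine (cancel_epi (Scheme.ΓSpecIso (.of A)).inv).1 ?_
  ext a
  exact congr($h a)

/-- The adjunction between global sections and `Spec`, over `K`. -/
theorem exists_hom_specOver (W : Over (Spec (.of K))) (h : A →+* Γ(W.left, ⊤))
    (hh : h.comp (algebraMap K A) = structureHom W) :
    ∃ m : W ⟶ specOver K A, ∀ x a, evalSpec (x ≫ m) a = evalAt W (h a) x := by
  refine ⟨Over.homMk (W.left.toSpecΓ ≫ Spec.map (CommRingCat.ofHom h)) ?_, ?_⟩
  · have h' : CommRingCat.ofHom (algebraMap K A) ≫ CommRingCat.ofHom h =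
        (Scheme.ΓSpecIso (.of K)).inv ≫ W.hom.appTop := by
      ext c
      exact congr($hh c)
    change (_ ≫ _) ≫ Spec.map (CommRingCat.ofHom (algebraMap K A)) = _
    rw [Category.assoc, ← Spec.map_comp, h', Spec.map_comp, ← Scheme.toSpecΓ_naturality_assoc,
      toSpecΓ_SpecMap_ΓSpecIso_inv]
    exact Category.comp_id _
  · intro x a
    rw [evalSpec_apply, evalAt_comp]
    congr 1
    have h' : (Scheme.ΓSpecIso (.of A)).inv ≫
        (W.left.toSpecΓ ≫ Spec.map (CommRingCat.ofHom h)).appTop = CommRingCat.ofHom h := by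
      rw [Scheme.Hom.comp_appTop, ← Scheme.ΓSpecIso_inv_naturality_assoc, Scheme.toSpecΓ_appTop,
        Iso.inv_hom_id]
      exact Category.comp_id _
    exact congr($h' a)

theorem evalSpec_surjective : Function.Surjective (evalSpec (K := K) (A := A)) := by
  intro φ
  obtain ⟨m, hm⟩ := exists_hom_specOver (A := A) (Over.mk (𝟙 (Spec (.of K))))
    ((Scheme.ΓSpecIso (.of K)).inv.hom.comp φ.toRingHom) (by
      ext c
      simp [structureHom])
  refine ⟨m, AlgHom.ext fun a => ?_⟩
  rw [← Category.id_comp m, hm]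
  simp [evalAt]

theorem exists_hom_affineLine (W : Over (Spec (.of K))) (g : Γ(W.left, ⊤)) :
    ∃ m : W ⟶ affineLine K, ∀ x, affineLineCoord (x ≫ m) = evalAt W g x := by
  obtain ⟨m, hm⟩ := exists_hom_specOver (A := Polynomial K) W
    (Polynomial.eval₂RingHom (structureHom W) g) (by ext; simp)
  exact ⟨m, fun x => by simpa using! hm x .X⟩

theorem isVariety_specOver [Algebra.FiniteType K A] : IsVariety (specOver K A) := by
  have : LocallyOfFiniteType (specOver K A).hom :=
    (HasRingHomProperty.Spec_iff (P := @LocallyOfFiniteType)).2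
      ((RingHom.finiteType_algebraMap).2 inferInstance)
  exact isVariety_of_isAffine _

theorem isVariety_affineLine : IsVariety (affineLine K) :=
  isVariety_specOver (A := Polynomial K)

variable {B : Type u} [CommRing B] [Algebra K B] [Algebra A B] [IsScalarTower K A B]

variable (K A B) in
/-- The morphism of spectra attached to an algebra. -/
noncomputable def specOverMap : specOver K B ⟶ specOver K A :=
  Over.homMk (Spec.map (CommRingCat.ofHom (algebraMap A B))) (by
    simp [specOver, ← Spec.map_comp, ← CommRingCat.ofHom_comp, ← IsScalarTower.algebraMap_eq])

theorem evalSpec_comp_specOverMap (x : RationalPoints (specOver K B)) (a : A) :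
    evalSpec (x ≫ specOverMap K A B) a = evalSpec x (algebraMap A B a) := by
  rw [evalSpec_apply, evalAt_comp, evalSpec_apply]
  congr 1
  exact congr($(Scheme.ΓSpecIso_inv_naturality (CommRingCat.ofHom (algebraMap A B))) a).symm

instance etale_specOverMap [Algebra.Etale A B] : Etale (specOverMap K A B).left :=
  (HasRingHomProperty.Spec_iff (P := @Etale)).2 (RingHom.etale_algebraMap.2 inferInstance)

end Affine

/-! ### Comparison of the topologies on rational points -/

section Topologies

variable {K : Type u} [Field K]

theorem continuous_evalAt_affinePointsTopology (τ : TopologicalSpace K) (V : Over (Spec (.of K)))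
    (g : Γ(V.left, ⊤)) : @Continuous _ _ (affinePointsTopology τ V) τ (evalAt V g) :=
  continuous_iInf_dom (i := g) continuous_induced_dom

theorem continuous_comp_affinePointsTopology (τ : TopologicalSpace K) {V W : Over (Spec (.of K))}
    (f : V ⟶ W) : @Continuous _ _ (affinePointsTopology τ V) (affinePointsTopology τ W)
      (fun x => x ≫ f) := by
  refine continuous_iInf_rng.2 fun g => continuous_induced_rng.2 ?_
  have : evalAt W g ∘ (fun x => x ≫ f) = evalAt V (f.left.appTop g) :=
    funext fun x => evalAt_comp f g x
  rw [this]
  exact continuous_evalAt_affinePointsTopology τ V _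

theorem continuous_evalAt_pointsTopology (τ : TopologicalSpace K) (V : Over (Spec (.of K)))
    (g : Γ(V.left, ⊤)) : @Continuous _ _ (pointsTopology τ V) τ (evalAt V g) := by
  refine continuous_iSup_dom.2 fun U => continuous_coinduced_dom.2 ?_
  have : evalAt V g ∘ (fun x => x ≫ openInclusion V U.1) =
      evalAt _ ((openInclusion V U.1).left.appTop g) :=
    funext fun x => evalAt_comp _ g x
  rw [this]
  exact continuous_evalAt_affinePointsTopology τ _ _

/-- The whole of an affine `V` is one of the affine pieces used in the gluing. -/
theorem affinePointsTopology_le_pointsTopology (τ : TopologicalSpace K) (V : Over (Spec (.of K)))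
    [IsAffine V.left] : affinePointsTopology τ V ≤ pointsTopology τ V := by
  let s : V ⟶ openSubscheme V ⊤ := Over.homMk V.left.topIso.inv (by
    simp [openSubscheme])
  have hs : s ≫ openInclusion V ⊤ = 𝟙 V := by
    ext1
    exact V.left.toIso_inv_ι
  intro S hS
  have hS' := isOpen_coinduced.1 (isOpen_iSup_iff.1 hS ⟨⊤, isAffineOpen_top V.left⟩)
  have := continuous_def.1 (continuous_comp_affinePointsTopology τ s) _ hS'
  simpa [← Set.preimage_comp, Function.comp_def, hs] using this

theorem factors_fromSpec {X : Scheme.{u}} {U : X.Opens} (hU : IsAffineOpen U)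
    (x : Spec (.of K) ⟶ X) (i : ⊤ ≤ x ⁻¹ᵁ U) :
    Spec.map (x.appLE U ⊤ i ≫ (Scheme.ΓSpecIso (.of K)).hom) ≫ hU.fromSpec = x := by
  rw [Spec.map_comp, Category.assoc, hU.SpecMap_appLE_fromSpec x (isAffineOpen_top _) i,
    IsAffineOpen.fromSpec_top, Scheme.isoSpec_Spec_inv, ← Category.assoc, ← Spec.map_comp,
    Iso.inv_hom_id, Spec.map_id, Category.id_comp]

theorem top_le_preimage_iff {X : Scheme.{u}} (x : Spec (.of K) ⟶ X) (U : X.Opens) :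
    ⊤ ≤ x ⁻¹ᵁ U ↔ x (IsLocalRing.closedPoint K) ∈ U := by
  refine ⟨fun h => h trivial, fun h p _ => ?_⟩
  have : Subsingleton (Spec (.of K)) := inferInstanceAs (Subsingleton (PrimeSpectrum K))
  rwa [Subsingleton.elim p (IsLocalRing.closedPoint K)]

/-- A point of an affine open subscheme, as a homomorphism on the sections over the open set. -/
noncomputable def evalOpen (W : Over (Spec (.of K))) (U : W.left.Opens)
    (t : RationalPoints (openSubscheme W U)) : Γ(W.left, U) →+* K :=
  (evalHom (openSubscheme W U) t).comp U.topIso.inv.hom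

theorem evalOpen_eq (W : Over (Spec (.of K))) (U : W.left.Opens)
    (t : RationalPoints (openSubscheme W U))
    (i : ⊤ ≤ (t ≫ openInclusion W U).left ⁻¹ᵁ U) :
    CommRingCat.ofHom (evalOpen W U t) =
      (t ≫ openInclusion W U).left.appLE U ⊤ i ≫ (Scheme.ΓSpecIso (.of K)).hom := by
  have h : U.topIso.inv = U.ι.appLE U ⊤ (by simp) := by
    rw [Scheme.Opens.ι_appLE]
    rfl
  have h' : t.left.appTop = t.left.appLE ⊤ ⊤ le_rfl := Scheme.Hom.app_eq_appLE _
  have : U.topIso.inv ≫ t.left.appTop = (t ≫ openInclusion W U).left.appLE U ⊤ i := by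
    rw [h, h']
    exact Scheme.Hom.appLE_comp_appLE _ _ _ _ _ _ _
  rw [← this]
  rfl

theorem isOpen_pointsTopology_of_isEtaleImage {τ : TopologicalSpace K} (hτ : IsFieldTopology K τ)
    (hgt : IsGtHenselian τ) {W : Over (Spec (.of K))} {S : Set (RationalPoints W)}
    (hS : IsEtaleImage W S) : IsOpen[pointsTopology τ W] S := by
  obtain ⟨V, hV, f, hf, rfl⟩ := hS
  have := hτ.isTopologicalDivisionRing
  have := hτ.t2
  refine isOpen_iSup_iff.2 fun ⟨U, hU⟩ => isOpen_coinduced.2 ?_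
  let _ := affinePointsTopology τ (openSubscheme W U)
  refine isOpen_iff_mem_nhds.2 ?_
  rintro t₀ ⟨v, hv⟩
  have hmem : ∀ t : RationalPoints (openSubscheme W U),
      ⊤ ≤ (t ≫ openInclusion W U).left ⁻¹ᵁ U := by
    intro t
    rw [top_le_preimage_iff]
    exact (t.left _).2
  have hv' : v.left ≫ f.left = (t₀ ≫ openInclusion W U).left := congr(($hv).left)
  have hq : v.left (IsLocalRing.closedPoint K) ∈ f.left ⁻¹ᵁ U := by
    have := (top_le_preimage_iff _ U).1 (hmem t₀)
    rw [← hv'] at this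
    exact this
  -- Shrinking `V` around the point `v` to an affine open over `U` leaves an étale ring map, whose
  -- homomorphisms to `K` can be deformed with `U(K)` as parameter space.
  obtain ⟨V', hV', hqV', e⟩ := exists_isAffineOpen_mem_and_subset hq
  have e : V' ≤ f.left ⁻¹ᵁ U := e
  have i := (top_le_preimage_iff v.left V').2 hqV'
  have het := f.left.etale_appLE hU hV' e
  algebraize [(f.left.appLE U V' e).hom]
  let φ : Γ(V.left, V') →+* K := (v.left.appLE V' ⊤ i ≫ (Scheme.ΓSpecIso (.of K)).hom).hom
  have hφ : φ.comp (algebraMap Γ(W.left, U) Γ(V.left, V')) = evalOpen W U t₀ := by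
    have : f.left.appLE U V' e ≫ v.left.appLE V' ⊤ i ≫ (Scheme.ΓSpecIso (.of K)).hom =
        CommRingCat.ofHom (evalOpen W U t₀) := by
      rw [evalOpen_eq W U t₀ (hmem t₀), Scheme.Hom.appLE_comp_appLE_assoc]
      simp only [hv']
    exact congr(($this).hom)
  filter_upwards [hgt.eventually_exists_ringHom_of_etale (evalOpen W U)
    (fun a => (continuous_evalAt_affinePointsTopology τ (openSubscheme W U)
      (U.topIso.inv a)).continuousAt) φ hφ] with t ⟨φ', hφ'⟩
  have hfac : Spec.map (CommRingCat.ofHom (evalOpen W U t)) ≫ hU.fromSpec =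
      (t ≫ openInclusion W U).left := by
    rw [evalOpen_eq W U t (hmem t)]
    exact factors_fromSpec hU _ (hmem t)
  have hx : (Spec.map (CommRingCat.ofHom φ') ≫ hV'.fromSpec) ≫ f.left =
      (t ≫ openInclusion W U).left := by
    rw [Category.assoc, ← IsAffineOpen.SpecMap_appLE_fromSpec f.left hU hV' e, ← Category.assoc,
      ← Spec.map_comp, ← hfac, ← hφ']
    rfl
  -- The new point is automatically over `K`, because its image in `W` is.
  refine ⟨Over.homMk (Spec.map (CommRingCat.ofHom φ') ≫ hV'.fromSpec) ?_, ?_⟩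
  · rw [← Over.w f, ← Category.assoc, hx]
    exact Over.w (t ≫ openInclusion W U)
  · ext1
    exact hx

theorem pointsTopology_le_etaleOpenTopology {τ : TopologicalSpace K} (hτ : IsFieldTopology K τ)
    (hgt : IsGtHenselian τ) (W : Over (Spec (.of K))) :
    pointsTopology τ W ≤ etaleOpenTopology W :=
  le_generateFrom fun _ hS => isOpen_pointsTopology_of_isEtaleImage hτ hgt hS

theorem exists_factor_opens_ι {X : Scheme.{u}} (x : Spec (.of K) ⟶ X) {U : X.Opens}
    (hU : x (IsLocalRing.closedPoint K) ∈ U) : ∃ l : Spec (.of K) ⟶ U, l ≫ U.ι = x := by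
  have hrange : Set.range x ⊆ Set.range U.ι := by
    rw [Scheme.Opens.range_ι]
    rintro _ ⟨p, rfl⟩
    exact (top_le_preimage_iff x U).2 hU (trivial : p ∈ _)
  exact ⟨_, IsOpenImmersion.lift_fac U.ι x hrange⟩

theorem exists_factor_openInclusion {W : Over (Spec (.of K))} (w : RationalPoints W)
    {U : W.left.Opens} (hU : w.left (IsLocalRing.closedPoint K) ∈ U) :
    ∃ w' : RationalPoints (openSubscheme W U), w' ≫ openInclusion W U = w := by
  obtain ⟨l, hlift⟩ := exists_factor_opens_ι w.left hU
  refine ⟨Over.homMk (l) ?_, ?_⟩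
  · refine (Category.assoc _ _ _).symm.trans ?_
    exact (congrArg (fun f => f ≫ W.hom) hlift).trans (Over.w w)
  · ext1
    exact hlift

/-- If the étale open topology on `K` refines `τ`, it does so on every variety. -/
theorem etaleOpenTopology_le_pointsTopology {τ : TopologicalSpace K}
    (h : ∀ W : Over (Spec (.of K)), IsVariety W → ∀ g : Γ(W.left, ⊤),
      @Continuous _ _ (etaleOpenTopology W) τ (evalAt W g))
    {W : Over (Spec (.of K))} (hW : IsVariety W) :
    etaleOpenTopology W ≤ pointsTopology τ W := by
  intro S hS
  refine (@TopologicalSpace.IsTopologicalBasis.isOpen_iff _ (etaleOpenTopology W) _ _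
    (isTopologicalBasis_etaleOpenTopology hW)).2 fun w hw => ?_
  obtain ⟨U, hU, hwU, -⟩ := exists_isAffineOpen_mem_and_subset
    (TopologicalSpace.Opens.mem_top (w.left (IsLocalRing.closedPoint K)))
  have hUV := isVariety_openSubscheme hW hU
  have hS' := isOpen_coinduced.1 (isOpen_iSup_iff.1 hS ⟨U, hU⟩)
  have hle : etaleOpenTopology (openSubscheme W U) ≤ affinePointsTopology τ (openSubscheme W U) :=
    le_iInf fun g => continuous_iff_le_induced.1 (h _ hUV g)
  obtain ⟨w', hw'⟩ := exists_factor_openInclusion w hwU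
  obtain ⟨E, hE, hwE, hES⟩ := (@TopologicalSpace.IsTopologicalBasis.isOpen_iff _
    (etaleOpenTopology (openSubscheme W U)) _ _ (isTopologicalBasis_etaleOpenTopology hUV)).1 (hle _ hS') w' (by simpa [hw'] using hw)
  -- Open immersions are étale, so an étale image in `U(K)` is one in `W(K)`.
  have : Etale (openInclusion W U).left := inferInstanceAs (Etale U.ι)
  refine ⟨_, hE.image (openInclusion W U), ⟨w', hwE, hw'⟩, ?_⟩
  rintro _ ⟨x, hx, rfl⟩
  exact hES hx

end Topologies

/-! ### Étale images in `K` -/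

section EtaleImagesInField

open Polynomial

variable {K : Type u} [Field K]

theorem affineLineCoord_bijective : Function.Bijective (affineLineCoord (K := K)) := by
  constructor
  · intro x y h
    refine evalSpec_injective (A := K[X]) (Polynomial.algHom_ext ?_)
    simpa only [affineLineCoord_eq] using h
  · intro c
    obtain ⟨x, hx⟩ := evalSpec_surjective (Polynomial.aeval (R := K) c)
    exact ⟨x, by simpa [hx] using affineLineCoord_eq x⟩

theorem evalAt_add (V : Over (Spec (.of K))) (g h : Γ(V.left, ⊤)) (x : RationalPoints V) :
    evalAt V (g + h) x = evalAt V g x + evalAt V h x :=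
  map_add (evalHom V x) g h

theorem evalAt_mul (V : Over (Spec (.of K))) (g h : Γ(V.left, ⊤)) (x : RationalPoints V) :
    evalAt V (g * h) x = evalAt V g x * evalAt V h x :=
  map_mul (evalHom V x) g h

theorem IsEtaleImageInField.isEtaleImage_preimage {U : Set K} (hU : IsEtaleImageInField U)
    {W : Over (Spec (.of K))} (hW : IsVariety W) (g : Γ(W.left, ⊤)) :
    IsEtaleImage W {x | evalAt W g x ∈ U} := by
  obtain ⟨S, hS, rfl⟩ := hU
  obtain ⟨m, hm⟩ := exists_hom_affineLine W g
  convert hS.preimage isVariety_affineLine hW m using 1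
  ext x
  rw [Set.mem_ofPred_eq, ← hm x, affineLineCoord_bijective.1.mem_set_image, Set.mem_preimage]

theorem IsEtaleImageInField.isEtaleImage_affine_preimage {U : Set K} (hU : IsEtaleImageInField U)
    {W : Over (Spec (.of K))} (hW : IsVariety W) (g : Γ(W.left, ⊤)) (a b : K) :
    IsEtaleImage W {x | a * evalAt W g x + b ∈ U} := by
  convert hU.isEtaleImage_preimage hW (structureHom W a * g + structureHom W b) using 4
  rw [evalAt_add, evalAt_mul, evalAt_structureHom, evalAt_structureHom]

theorem IsEtaleImageInField.affine_preimage {U : Set K} (hU : IsEtaleImageInField U) (a b : K) :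
    IsEtaleImageInField {y | a * y + b ∈ U} := by
  refine ⟨_, hU.isEtaleImage_affine_preimage isVariety_affineLine
    ((Scheme.ΓSpecIso (.of (Polynomial K))).inv Polynomial.X) a b, ?_⟩
  exact (Set.image_preimage_eq {y | a * y + b ∈ U} affineLineCoord_bijective.2).symm

/-- A bounded étale image makes the étale open topology finer than `τ`. -/
theorem continuous_evalAt_etaleOpenTopology {τ : TopologicalSpace K} (hτ : IsFieldTopology K τ)
    {U : Set K} (hU : IsEtaleImageInField U) (hne : U.Nonempty) (hb : IsBounded τ U)
    {W : Over (Spec (.of K))} (hW : IsVariety W) (g : Γ(W.left, ⊤)) :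
    @Continuous _ _ (etaleOpenTopology W) τ (evalAt W g) := by
  have := hτ.isTopologicalDivisionRing
  refine continuous_def.2 fun O hO => ?_
  refine (@TopologicalSpace.IsTopologicalBasis.isOpen_iff _ (etaleOpenTopology W) _ _
    (isTopologicalBasis_etaleOpenTopology hW)).2 fun w hw => ?_
  obtain ⟨u, hu⟩ := hne
  set b := evalAt W g w with hbdef
  have hO' : (fun p : K × K => b + (p.1 - p.2)) ⁻¹' O ∈ 𝓝 ((0 : K), (0 : K)) := by
    have : ContinuousAt (fun p : K × K => b + (p.1 - p.2)) (0, 0) := by fun_prop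
    exact this (by simpa using hO.mem_nhds hw)
  rw [nhds_prod_eq, Filter.mem_prod_self_iff] at hO'
  obtain ⟨N, hN, hNO⟩ := hO'
  obtain ⟨V, hV, hVU⟩ := hb N hN
  -- If `V` were `{0}` at most, `τ` would be discrete.
  obtain ⟨a, haV, ha⟩ : ∃ a ∈ V, a ≠ 0 := by
    by_contra! h
    refine hτ.not_discrete (discreteTopology_of_isOpen_singleton_zero ?_)
    exact isOpen_singleton_iff_nhds_eq_pure _ |>.2 (le_antisymm
      (Filter.le_pure_iff.2 (Filter.mem_of_superset hV h)) (pure_le_nhds _))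
  -- This is the locus where `g` takes values in `a (U - u) + b`, a set that contains `b` and lies
  -- in `O` because `a U ⊆ N`.
  refine ⟨_, hU.isEtaleImage_affine_preimage hW g a⁻¹ (u - a⁻¹ * b), ?_, ?_⟩
  · simpa [← hbdef] using hu
  · intro x hx
    have hx' : a⁻¹ * evalAt W g x + (u - a⁻¹ * b) ∈ U := hx
    have := @hNO (a * (a⁻¹ * evalAt W g x + (u - a⁻¹ * b)), a * u)
      ⟨hVU (Set.mul_mem_mul haV hx'), hVU (Set.mul_mem_mul haV hu)⟩
    rw [Set.mem_preimage] at this ⊢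
    convert this using 1
    field_simp
    ring

theorem exists_isBounded_isEtaleImageInField {τ : TopologicalSpace K}
    (hlb : IsLocallyBounded τ) (h : InducesEtaleOpenTopology τ) :
    ∃ U : Set K, IsEtaleImageInField U ∧ U.Nonempty ∧ IsBounded τ U := by
  obtain ⟨B, hB, hBb⟩ := hlb
  obtain ⟨O, hOB, hO, hO0⟩ := mem_nhds_iff.1 hB
  obtain ⟨x, hx⟩ := affineLineCoord_bijective.2 (0 : K)
  have hopen : IsOpen[etaleOpenTopology (affineLine K)] (affineLineCoord ⁻¹' O) := by
    rw [← h _ isVariety_affineLine]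
    exact continuous_def.1 (continuous_evalAt_pointsTopology τ (affineLine K) _) _ hO
  obtain ⟨E, hE, hxE, hEO⟩ := (@TopologicalSpace.IsTopologicalBasis.isOpen_iff _
    (etaleOpenTopology (affineLine K)) _ _
    (isTopologicalBasis_etaleOpenTopology isVariety_affineLine)).1 hopen x (by simpa [hx] using hO0)
  refine ⟨_, ⟨E, hE, rfl⟩, ⟨_, x, hxE, rfl⟩, fun N hN => ?_⟩
  obtain ⟨V, hV, hVN⟩ := hBb N hN
  exact ⟨V, hV, (Set.mul_subset_mul_left
    ((Set.image_subset_iff.2 hEO).trans hOB)).trans hVN⟩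

end EtaleImagesInField

/-! ### The generic polynomial -/

section Generic

open Polynomial

variable (K : Type u) [Field K] (n : ℕ)

/-- The polynomial `X ^ (n + 1) + X ^ n + a (n - 1) X ^ (n - 1) + ⋯ + a 0` with coefficients
`a i` of a ring. -/
noncomputable def henselPolynomial {A : Type u} [CommRing A] (a : Fin n → A) : A[X] :=
  X ^ (n + 1) + (X ^ n + ∑ i : Fin n, C (a i) * X ^ (i : ℕ))

variable {n} in
theorem monic_henselPolynomial {A : Type u} [CommRing A] (a : Fin n → A) :
    (henselPolynomial n a).Monic := by
  refine monic_X_pow_add ((degree_add_le _ _).trans_lt (max_lt ?_ ?_))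
  · exact (degree_X_pow_le n).trans_lt (by exact_mod_cast n.lt_succ_self)
  · exact (degree_sum_fin_lt a).trans (by exact_mod_cast n.lt_succ_self)

variable {n} in
theorem map_henselPolynomial {A B : Type u} [CommRing A] [CommRing B] (f : A →+* B)
    (a : Fin n → A) : (henselPolynomial n a).map f = henselPolynomial n (fun i => f (a i)) := by
  simp [henselPolynomial, Polynomial.map_sum]

variable {n} in
theorem eval_henselPolynomial {A : Type u} [CommRing A] (a : Fin n → A) (x : A) :
    (henselPolynomial n a).eval x = x ^ (n + 1) + x ^ n + ∑ i : Fin n, a i * x ^ (i : ℕ) := by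
  simp [henselPolynomial, eval_finsetSum, add_assoc]

theorem eval_henselPolynomial_zero :
    (henselPolynomial n (0 : Fin n → K)).eval (-1) = 0 := by
  simp [eval_henselPolynomial, pow_succ]

theorem eval_derivative_henselPolynomial_zero :
    (derivative (henselPolynomial n (0 : Fin n → K))).eval (-1) ≠ 0 := by
  -- The value `(n + 1) (-1) ^ n + n (-1) ^ (n - 1)` collapses to `(-1) ^ n`, nonzero in every
  -- characteristic.
  have : (derivative (henselPolynomial n (0 : Fin n → K))).eval (-1) = (-1) ^ n := by
    rcases n with _ | n
    · simp [henselPolynomial]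
    · simp [henselPolynomial, pow_succ]
      ring
  rw [this]
  exact pow_ne_zero _ (by simp)

/-- The étale locus of the generic polynomial over affine `n`-space. -/
noncomputable def henselPair : StandardEtalePair (MvPolynomial (Fin n) K) where
  f := henselPolynomial n MvPolynomial.X
  monic_f := monic_henselPolynomial _
  g := derivative (henselPolynomial n MvPolynomial.X)
  cond := ⟨1, 0, 1, by simp⟩

noncomputable instance algebraHenselRing : Algebra K (henselPair K n).Ring :=
  ((algebraMap (MvPolynomial (Fin n) K) (henselPair K n).Ring).comp
    (algebraMap K (MvPolynomial (Fin n) K))).toAlgebra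

instance isScalarTower_henselRing :
    IsScalarTower K (MvPolynomial (Fin n) K) (henselPair K n).Ring :=
  .of_algebraMap_eq' rfl

instance finiteType_henselRing : Algebra.FiniteType K (henselPair K n).Ring :=
  Algebra.FiniteType.trans (S := MvPolynomial (Fin n) K) inferInstance inferInstance

variable {K n}

theorem henselPair_root (φ : (henselPair K n).Ring →+* K) :
    (φ (henselPair K n).X) ^ (n + 1) + (φ (henselPair K n).X) ^ n + ∑ i : Fin n,
      φ (algebraMap (MvPolynomial (Fin n) K) _ (.X i)) * (φ (henselPair K n).X) ^ (i : ℕ) = 0 := by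
  have := congrArg φ (henselPair K n).hasMap_X.1
  rw [aeval_def, hom_eval₂, map_zero, eval₂_eq_eval_map] at this
  change ((henselPolynomial n MvPolynomial.X).map _).eval _ = 0 at this
  rwa [map_henselPolynomial, eval_henselPolynomial] at this

theorem exists_henselPair_algHom (a : Fin n → K) {x : K}
    (h0 : (henselPolynomial n a).eval x = 0)
    (h1 : (derivative (henselPolynomial n a)).eval x ≠ 0) :
    ∃ φ : (henselPair K n).Ring →ₐ[K] K, φ (henselPair K n).X = x ∧
      ∀ p, φ (algebraMap (MvPolynomial (Fin n) K) _ p) = MvPolynomial.aeval a p := by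
  let ψ : MvPolynomial (Fin n) K →ₐ[K] K := MvPolynomial.aeval a
  let _ : Algebra (MvPolynomial (Fin n) K) K := ψ.toRingHom.toAlgebra
  have : IsScalarTower K (MvPolynomial (Fin n) K) K := .of_algebraMap_eq' ψ.comp_algebraMap.symm
  have hmap : (henselPolynomial n MvPolynomial.X).map (algebraMap (MvPolynomial (Fin n) K) K) =
      henselPolynomial n a := by
    rw [map_henselPolynomial]
    exact congrArg _ (funext fun i => MvPolynomial.aeval_X a i)
  have hM : (henselPair K n).HasMap x := by
    constructor
    · rw [aeval_def, eval₂_eq_eval_map]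
      exact (congrArg (eval x) hmap).trans h0
    · rw [aeval_def, eval₂_eq_eval_map]
      refine Ne.isUnit ?_
      change eval x ((derivative _).map _) ≠ 0
      rwa [← derivative_map, hmap]
  refine ⟨((henselPair K n).lift x hM).restrictScalars K, (henselPair K n).lift_X x hM, fun p => ?_⟩
  exact ((henselPair K n).lift x hM).commutes p

/-- The pair `(0, -1)` is a point of the étale locus. Around it, an étale image on which the root
lies in `P` projects to an étale image in the coefficient space, hence to a `τ`-neighbourhood of
`0`; every coefficient vector there lifts to a root in `P`. -/
theorem isGtHenselian_of_inducesEtaleOpenTopology {τ : TopologicalSpace K}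
    (hτ : IsFieldTopology K τ) (h : InducesEtaleOpenTopology τ) : IsGtHenselian τ := by
  intro n P hP
  have := hτ.isTopologicalDivisionRing
  obtain ⟨P', hPP', hP', hmP'⟩ := mem_nhds_iff.1 hP
  let A := MvPolynomial (Fin n) K
  let B := (henselPair K n).Ring
  obtain ⟨φ, hφX, hφ⟩ := exists_henselPair_algHom (n := n) (0 : Fin n → K) (x := -1)
    (eval_henselPolynomial_zero K n) (eval_derivative_henselPolynomial_zero K n)
  obtain ⟨v, hv⟩ := evalSpec_surjective φ
  have hA : IsVariety (specOver K A) := isVariety_specOver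
  have hB : IsVariety (specOver K B) := isVariety_specOver
  have hopen : IsOpen[etaleOpenTopology (specOver K B)]
      (evalAt (specOver K B) (specFun K (henselPair K n).X) ⁻¹' P') := by
    rw [← h _ hB]
    exact continuous_def.1 (continuous_evalAt_pointsTopology τ _ _) _ hP'
  obtain ⟨E, hE, hvE, hEP⟩ := (@TopologicalSpace.IsTopologicalBasis.isOpen_iff _
    (etaleOpenTopology (specOver K B)) _ _ (isTopologicalBasis_etaleOpenTopology hB)).1 hopen v
    (by rw [Set.mem_preimage, ← evalSpec_apply, hv, hφX]; exact hmP')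
  have hE' : IsOpen[affinePointsTopology τ (specOver K A)]
      ((fun x => x ≫ specOverMap K A B) '' E) := by
    refine affinePointsTopology_le_pointsTopology τ _ _ ?_
    rw [h _ hA]
    exact TopologicalSpace.isOpen_generateFrom_of_mem (hE.image _)
  choose pt hpt using fun a : Fin n → K => evalSpec_surjective (MvPolynomial.aeval (R := K) a)
  have hcont : @Continuous _ _ _ (affinePointsTopology τ (specOver K A)) pt := by
    refine continuous_iInf_rng.2 fun g => continuous_induced_rng.2 ?_
    obtain ⟨p, rfl⟩ : ∃ p : A, specFun K p = g :=
      ⟨(Scheme.ΓSpecIso (.of A)).hom g, congr($((Scheme.ΓSpecIso (.of A)).hom_inv_id) g)⟩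
    have : evalAt (specOver K A) (specFun K p) ∘ pt = fun a => MvPolynomial.eval a p := by
      funext a
      rw [Function.comp_apply, ← evalSpec_apply, hpt]
      exact congr($(MvPolynomial.coe_aeval_eq_eval a) p)
    rw [this]
    exact MvPolynomial.continuous_eval p
  have hpt0 : v ≫ specOverMap K A B = pt 0 := by
    refine evalSpec_injective (AlgHom.ext fun p => ?_)
    rw [evalSpec_comp_specOverMap, hv, hφ, hpt]
  have hnhds : pt ⁻¹' ((fun x => x ≫ specOverMap K A B) '' E) ∈ 𝓝 (0 : Fin n → K) :=
    (continuous_def.1 hcont _ hE').mem_nhds ⟨v, hvE, hpt0⟩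
  rw [nhds_pi, Filter.mem_pi'] at hnhds
  obtain ⟨I, t, ht, hsub⟩ := hnhds
  -- There are finitely many coordinates, so one neighbourhood `O` serves for all coefficients.
  refine ⟨⋂ i, t i, Filter.iInter_mem.2 ht, fun a ha => ?_⟩
  obtain ⟨x, hxE, hx⟩ := hsub (show a ∈ _ from fun i _ => Set.mem_iInter.1 (ha i) i)
  refine ⟨evalSpec x (henselPair K n).X, hPP' (hEP hxE), ?_⟩
  have hroot := henselPair_root (evalSpec x).toRingHom
  have hco : ∀ i, evalSpec x (algebraMap A B (.X i)) = a i := by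
    intro i
    rw [← evalSpec_comp_specOverMap]
    simp only at hx
    rw [hx, hpt, MvPolynomial.aeval_X]
  simpa only [← hco] using! hroot

end Generic

/-! ### The main result -/

theorem inducesEtaleOpenTopology_iff {K : Type u} [Field K] {τ : TopologicalSpace K}
    (hτ : IsFieldTopology K τ) (hlb : IsLocallyBounded τ) :
    InducesEtaleOpenTopology τ ↔ IsGtHenselian τ ∧
      ∃ U : Set K, IsEtaleImageInField U ∧ U.Nonempty ∧ IsBounded τ U := by
  refine ⟨fun h => ⟨isGtHenselian_of_inducesEtaleOpenTopology hτ h,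
    exists_isBounded_isEtaleImageInField hlb h⟩, ?_⟩
  rintro ⟨hgt, U, hU, hne, hb⟩ W hW
  exact le_antisymm (pointsTopology_le_etaleOpenTopology hτ hgt W)
    (etaleOpenTopology_le_pointsTopology
      (fun _ hV g => continuous_evalAt_etaleOpenTopology hτ hU hne hb hV g) hW)

theorem exists_isBounded_isEtaleImageInField_adicTopology_iff {K : Type u} [Field K] {R : Type v}
    [CommRing R] [IsDomain R] [Algebra R K] [IsFractionRing R K] :
    (∃ U : Set K, IsEtaleImageInField U ∧ U.Nonempty ∧ IsBounded (adicTopology R K) U) ↔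
      ∃ U : Set K, IsEtaleImageInField U ∧ U.Nonempty ∧ U ⊆ Set.range (algebraMap R K) := by
  constructor
  · rintro ⟨U, hU, ⟨u, hu⟩, hb⟩
    obtain ⟨V, hV, hVU⟩ := hb _ (range_algebraMap_mem_nhds_zero R)
    obtain ⟨a, ha, haV⟩ := (nhds_adicTopology_hasBasis R (0 : K)).mem_iff.1 hV
    have haV : a ∈ V := haV ⟨1, by simp⟩
    -- This set is `a U`, where `a ≠ 0` was chosen by boundedness so that `a U ⊆ R`.
    refine ⟨_, hU.affine_preimage a⁻¹ 0, ⟨a * u, by simpa [ha] using hu⟩, fun y hy => ?_⟩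
    have := hVU (Set.mul_mem_mul haV hy)
    simpa [ha] using this
  · rintro ⟨U, hU, hne, hsub⟩
    refine ⟨U, hU, hne, fun N hN => ?_⟩
    obtain ⟨V, hV, hVN⟩ := isBounded_adicTopology_range R N hN
    exact ⟨V, hV, (Set.mul_subset_mul_left hsub).trans hVN⟩

end EtaleOpen

theorem proposition7p14 {K : Type u} [Field K] :
    (∀ τ : TopologicalSpace K, EtaleOpen.IsFieldTopology K τ → EtaleOpen.IsLocallyBounded τ →
      (EtaleOpen.InducesEtaleOpenTopology τ ↔
        EtaleOpen.IsGtHenselian τ ∧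
          ∃ U : Set K, EtaleOpen.IsEtaleImageInField U ∧ U.Nonempty ∧ EtaleOpen.IsBounded τ U)) ∧
    (∀ (R : Type v) [CommRing R] [IsDomain R] [IsLocalRing R] [Algebra R K] [IsFractionRing R K],
      ¬ Function.Surjective (algebraMap R K) →
      (EtaleOpen.InducesEtaleOpenTopology (EtaleOpen.adicTopology R K) ↔
        EtaleOpen.IsGtHenselian (EtaleOpen.adicTopology R K) ∧
          ∃ U : Set K, EtaleOpen.IsEtaleImageInField U ∧ U.Nonempty ∧
            U ⊆ Set.range (algebraMap R K))) := by
  refine ⟨fun τ hτ hlb => EtaleOpen.inducesEtaleOpenTopology_iff hτ hlb, ?_⟩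
  intro R _ _ _ _ _ hR
  rw [← EtaleOpen.exists_isBounded_isEtaleImageInField_adicTopology_iff]
  exact EtaleOpen.inducesEtaleOpenTopology_iff (EtaleOpen.isFieldTopology_adicTopology R hR)
    (EtaleOpen.isLocallyBounded_adicTopology R)
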